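/- **Setting.** For $K'\ge 1$ let $\Theta_{K'}$ be the set of $\theta=(\pi,H)$ with $\pi_a>0$, $\sum_{a=1}^{K'}\pi_a=1$, and $H$ a symmetric $K'\times K'$ matrix with entries in $(0,1)$. In the stochastic block model on $n$ nodes with parameter $\theta\in\Theta_{K'}$, the labels $Z_1,\dots,Z_n\in[K']$ are i.i.d. with law $\pi$ and, given $Z$, the symmetric adjacency matrix $A$ has zero diagonal and independent entries $A_{i,j}\sim\mathrm{Bernoulli}(H_{Z_i,Z_j})$, $i<j$. For $z\in[K']^n$ put $n_a(z)=\#\{i:z_i=a\}$, $n_{a,b}(z)=\sum_{i}\sum_{j\ne i}\mathbb I(z_i=a,z_j=b)$, $O_{a,b}(z)=\sum_i\sum_{j\neq i}\mathbb I(z_i=a,z_j=b)A_{i,j}$, $$f(z,A;\theta)=\Big(\prod_{a}\pi_a^{n_a(z)}\Big)\Big(\prod_{a,b}H_{a,b}^{O_{a,b}(z)}(1-H_{a,b})^{n_{a,b}(z)-O_{a,b}(z)}\Big)^{1/2},\qquad g(A;\theta)=\sum_{z\in[K']^n}f(z,A;\theta),$$ $$L_{K,K'}=\log\frac{\sup_{\theta\in\Theta_{K'}}g(A;\theta)}{\sup_{\theta\in\Theta_K}g(A;\theta)}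 .$$ Let $K<K^+$ be fixed. For each $n$ let $(Z,A)$ be generated by the model with parameter $\theta^*=(\pi^*,\rho_nS^*)\in\Theta_K$, where $\pi^*$ and $S^*$ do not depend on $n$, $S^*$ has no two identical columns, and $n\rho_n/\log n\to\infty$. Let $\mathcal V$ be the set of $z\in[K^+]^n$ such that every block of $z$ is contained in a block of $Z$ (equivalently, every row of the confusion matrix $R_{k,a}=n^{-1}\sum_i\mathbb I(z_i=k,Z_i=a)$ has at most one nonzero entry), and for $\epsilon>0$ let $\mathcal N_\epsilon=\{z\in\mathcal V: n_k(z)\ge\epsilon n\text{ for all }k\in[K^+]\}$. **Assumption.** For some fixed $\epsilon>0$ and $C\ge 0$, with probability tending to one there is a $z\in\mathcal N_\epsilon$ with $$\sup_{\theta\in\Theta_{K^+}}f(z',A;\theta)\le e^{Cn}\sup_{\theta\in\Theta_{K^+}}f(z,A;\theta)\qquad\text{for all } z'\in\mathcal V .$$ (For $C=0$ this says that the maximum over $\mathcal V$ of $\sup_\theta f(z,A;\theta)$ is attained in $\mathcal N_\epsilon$, i.e. on a loosely balanced splitting of the true blocks.) **Theorem.** Under this assumption $L_{K,K^+}=O_P(n)$.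 Consequently a penalty of order $n\log n$ excludes the overfitted model: for every constant $\lambda>0$ the criterion $$\beta(K')=\sup_{\theta\in\Theta_{K'}}\log g(A;\theta)-\lambda\,\frac{K'(K'+1)}2\,n\log n$$ satisfies $\mathbb P(\beta(K^+)<\beta(K))\to1$. -/

import Mathlib

open Filter Topology Finset
open scoped BigOperators ENNReal Classical

noncomputable section

namespace SBM

/-- The parameter space `Θ_K` of a `K`-block model: block probabilities `π` (strictly positive and
summing to one) and a symmetric matrix `H` of edge probabilities in `(0, 1)`. -/
structure Param (K : ℕ) where
  prob : Fin K → ℝ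
  conn : Matrix (Fin K) (Fin K) ℝ
  prob_pos : ∀ a, 0 < prob a
  prob_sum : ∑ a, prob a = 1
  conn_symm : conn.IsSymm
  conn_pos : ∀ a b, 0 < conn a b
  conn_lt_one : ∀ a b, conn a b < 1

/-- A labeling of `n` nodes by `K` block labels. -/
abbrev Labeling (n K : ℕ) : Type := Fin n → Fin K

/-- A realization of the model: the labels `Z` and the undirected loopless graph with adjacency
matrix `A`. -/
abbrev Outcome (n K : ℕ) : Type := Labeling n K × SimpleGraph (Fin n)

/-! ### The law of `(Z, A)` -/

/-- Probability of the label vector `z` when the labels are i.i.d. with law `π`. -/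
def labelWeight {n K : ℕ} (θ : Param K) (z : Labeling n K) : ℝ :=
  ∏ i, θ.prob (z i)

/-- Conditional probability of the graph `A` given the labels `z`: the edges `{i, j}`, `i < j`, are
independent, and `{i, j}` is present with probability `H (z i) (z j)`. -/
def graphWeight {n K : ℕ} (θ : Param K) (z : Labeling n K) (A : SimpleGraph (Fin n)) : ℝ :=
  ∏ e : Fin n × Fin n with e.1 < e.2,
    if A.Adj e.1 e.2 then θ.conn (z e.1) (z e.2) else 1 - θ.conn (z e.1) (z e.2)

theorem labelWeight_nonneg {n K : ℕ} (θ : Param K) (z : Labeling n K) : 0 ≤ labelWeight θ z :=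
  Finset.prod_nonneg fun _ _ => (θ.prob_pos _).le

theorem graphWeight_nonneg {n K : ℕ} (θ : Param K) (z : Labeling n K) (A : SimpleGraph (Fin n)) :
    0 ≤ graphWeight θ z A := by
  refine Finset.prod_nonneg fun e _ => ?_
  split_ifs
  · exact (θ.conn_pos _ _).le
  · linarith [θ.conn_lt_one (z e.1) (z e.2)]

theorem sum_labelWeight {n K : ℕ} (θ : Param K) : ∑ z : Labeling n K, labelWeight θ z = 1 := by
  unfold labelWeight
  rw [← Fintype.prod_sum (fun (_ : Fin n) a => θ.prob a)]
  simp [θ.prob_sum]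

theorem sum_graphWeight {n K : ℕ} (θ : Param K) (z : Labeling n K) :
    ∑ A : SimpleGraph (Fin n), graphWeight θ z A = 1 := by
  set s : Finset (Fin n × Fin n) := Finset.univ.filter fun e => e.1 < e.2 with hs
  have h1 : ∏ e ∈ s, (θ.conn (z e.1) (z e.2) + (1 - θ.conn (z e.1) (z e.2))) = 1 :=
    Finset.prod_eq_one fun e _ => by ring
  rw [Finset.prod_add] at h1
  rw [← h1]
  refine Finset.sum_bij' (fun A _ => s.filter fun e => A.Adj e.1 e.2)
    (fun t _ => SimpleGraph.fromRel fun i j => (i, j) ∈ t) ?_ ?_ ?_ ?_ ?_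
  · intro A _
    exact Finset.mem_powerset.2 (Finset.filter_subset _ _)
  · intro t _
    exact Finset.mem_univ _
  · intro A _
    ext i j
    simp only [SimpleGraph.fromRel_adj, Finset.mem_filter, hs, Finset.mem_univ, true_and]
    constructor
    · rintro ⟨_, h | h⟩
      · exact h.2
      · exact h.2.symm
    · intro h
      refine ⟨h.ne, ?_⟩
      rcases lt_or_gt_of_ne h.ne with h' | h'
      · exact Or.inl ⟨h', h⟩
      · exact Or.inr ⟨h', h.symm⟩
  · intro t ht
    have ht' : t ⊆ s := Finset.mem_powerset.1 ht
    have hlt : ∀ i j, (i, j) ∈ t → i < j := fun i j h => by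
      have := ht' h
      simpa [hs] using this
    ext ⟨i, j⟩
    simp only [Finset.mem_filter, hs, Finset.mem_univ, true_and, SimpleGraph.fromRel_adj]
    constructor
    · rintro ⟨hij, _, h | h⟩
      · exact h
      · exact absurd (hlt _ _ h) (not_lt.2 hij.le)
    · intro h
      exact ⟨hlt _ _ h, (hlt _ _ h).ne, Or.inl h⟩
  · intro A _
    unfold graphWeight
    rw [← hs, Finset.prod_ite, Finset.filter_not]

theorem sum_weight {n K : ℕ} (θ : Param K) :
    ∑ ω : Outcome n K, ENNReal.ofReal (labelWeight θ ω.1 * graphWeight θ ω.1 ω.2) = 1 := by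
  rw [← ENNReal.ofReal_sum_of_nonneg fun ω _ =>
    mul_nonneg (labelWeight_nonneg θ _) (graphWeight_nonneg θ _ _)]
  rw [Fintype.sum_prod_type]
  simp only [← Finset.mul_sum, sum_graphWeight, mul_one, sum_labelWeight, ENNReal.ofReal_one]

/-- The joint law of the labels and the graph on `n` nodes under the parameter `θ`. -/
def law {K : ℕ} (n : ℕ) (θ : Param K) : PMF (Outcome n K) :=
  PMF.ofFintype (fun ω => ENNReal.ofReal (labelWeight θ ω.1 * graphWeight θ ω.1 ω.2))
    (sum_weight θ)

/-! ### Count statistics and likelihoods -/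

/-- `n_a(z)`, the size of block `a`. -/
def blockSize {n K : ℕ} (z : Labeling n K) (a : Fin K) : ℕ :=
  ∑ i, if z i = a then 1 else 0

/-- `n_{a,b}(z)`, the number of ordered pairs of distinct nodes with labels `a`, `b`. -/
def pairCount {n K : ℕ} (z : Labeling n K) (a b : Fin K) : ℕ :=
  ∑ i, ∑ j ∈ Finset.univ.erase i, if z i = a ∧ z j = b then 1 else 0

/-- `O_{a,b}(z)`, the number of those ordered pairs which are joined by an edge. -/
def edgeCount {n K : ℕ} (A : SimpleGraph (Fin n)) (z : Labeling n K) (a b : Fin K) : ℕ :=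
  ∑ i, ∑ j ∈ Finset.univ.erase i, if z i = a ∧ z j = b ∧ A.Adj i j then 1 else 0

/-- The complete likelihood `f(z, A; θ)`. -/
def completeLik {n K : ℕ} (z : Labeling n K) (A : SimpleGraph (Fin n)) (θ : Param K) : ℝ :=
  (∏ a, θ.prob a ^ blockSize z a) *
    Real.sqrt (∏ a, ∏ b, θ.conn a b ^ edgeCount A z a b *
      (1 - θ.conn a b) ^ (pairCount z a b - edgeCount A z a b))

/-- The likelihood `g(A; θ)`. -/
def lik {n K : ℕ} (A : SimpleGraph (Fin n)) (θ : Param K) : ℝ :=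
  ∑ z : Labeling n K, completeLik z A θ

/-- `sup_{θ ∈ Θ_K} f(z, A; θ)`. -/
def maxCompleteLik {n K : ℕ} (z : Labeling n K) (A : SimpleGraph (Fin n)) : ℝ :=
  ⨆ θ : Param K, completeLik z A θ

/-- The log likelihood ratio `L_{K, K'}`. -/
def logLikRatio {n : ℕ} (K K' : ℕ) (A : SimpleGraph (Fin n)) : ℝ :=
  Real.log ((⨆ θ : Param K', lik A θ) / (⨆ θ : Param K, lik A θ))

/-- The penalized likelihood criterion `β(K')` with tuning parameter `lam`. -/
def criterion {n : ℕ} (lam : ℝ) (K' : ℕ) (A : SimpleGraph (Fin n)) : ℝ :=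
  (⨆ θ : Param K', Real.log (lik A θ)) -
    lam * ((K' : ℝ) * ((K' : ℝ) + 1) / 2) * ((n : ℝ) * Real.log n)

/-! ### Splittings of the true blocks -/

/-- The confusion matrix `R(z, Z)`. -/
def confusion {n K' K : ℕ} (z : Labeling n K') (Z : Labeling n K) :
    Matrix (Fin K') (Fin K) ℝ :=
  fun k a => (n : ℝ)⁻¹ * ∑ i, if z i = k ∧ Z i = a then (1 : ℝ) else 0

/-- The set `𝒱` of labelings such that every row of `R(z, Z)` has at most one nonzero entry, i.e.
every block of `z` is contained in a block of `Z`. -/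
def splittings {n K : ℕ} (K' : ℕ) (Z : Labeling n K) : Set (Labeling n K') :=
  {z | ∀ k a b, confusion z Z k a ≠ 0 → confusion z Z k b ≠ 0 → a = b}

/-- The set `𝒩` of loosely balanced splittings: all blocks have size at least `ε n`. -/
def balancedSplittings {n K : ℕ} (K' : ℕ) (ε : ℝ) (Z : Labeling n K) : Set (Labeling n K') :=
  {z | z ∈ splittings K' Z ∧ ∀ k, ε * n ≤ blockSize z k}

/-- With probability tending to one, some loosely balanced splitting attains the maximum of
`sup_θ f(z, A; θ)` over the splittings `z` of the true blocks, up to a factor `exp (C n)`.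
For `C = 0` the maximum is attained exactly. -/
def BalancedMax {K : ℕ} (θ : ℕ → Param K) (K' : ℕ) (ε C : ℝ) : Prop :=
  Tendsto (fun n : ℕ => (law n (θ n)).toOuterMeasure
      {ω | ∃ z ∈ balancedSplittings K' ε ω.1, ∀ z' ∈ splittings K' ω.1,
        maxCompleteLik z' ω.2 ≤ Real.exp (C * n) * maxCompleteLik z ω.2})
    atTop (𝓝 1)

/-! ### Stochastic order -/

/-- `X n = O_P(r n)`, where `X n` is a random variable on a probability space with law `P n`. -/
def IsBigOP {Ω : ℕ → Type*} (P : ∀ n, PMF (Ω n)) (X : ∀ n, Ω n → ℝ) (r : ℕ → ℝ) : Prop :=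
  ∀ δ : ℝ, 0 < δ → ∃ M : ℝ, ∀ᶠ n in atTop,
    (P n).toOuterMeasure {ω | M * |r n| < |X n ω|} ≤ ENNReal.ofReal δ

end SBM

end

namespace SBM

/-! ### The complete likelihood as a density -/

/-! The mechanism is a change of measure with a counting bound. The graph has density `lik A θ`
under the true parameter, and on the event `t < logLikRatio` this density is at most `exp (-t)`
times the supremum of the larger model's likelihood. Summing over graphs (`law_lt_logLikRatio_le`)
bounds the event's probability by `exp (-t)` times the total mass of that supremum, which is at most
the sum of `maxCompleteLik z A` over all `z` and `A`.

For fixed `z`, the maximized likelihood depends on `A` only through the edge counts. On each level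
set of these counts the maximization is the same for every graph, and each `completeLik z · θ` has
mass at most one, so the level set contributes at most one. There are at most `(n ^ 2 + 1) ^ (K' *
K')` level sets and `K' ^ n` labelings (`sum_sum_maxCompleteLik_le`). At `t = (log K' + 1) n` the
bound is `exp (-n)` times a polynomial, which vanishes.

The ratio is nonnegative because the models are nested (`lik_split`), so the upper tail gives
`O_P(n)`. The penalties differ by at least `lam * n * log n`, which eventually dominates. -/

theorem prod_pow_labelPairCount {n K : ℕ} (F : Fin K → Fin K → ℝ) (z : Labeling n K)
    (P : Fin n → Fin n → Prop) [∀ i j, Decidable (P i j)] :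
    ∏ a, ∏ b, F a b ^
        (∑ i, ∑ j ∈ Finset.univ.erase i, if z i = a ∧ z j = b ∧ P i j then 1 else 0) =
      ∏ i, ∏ j ∈ Finset.univ.erase i, if P i j then F (z i) (z j) else 1 := by
  simp only [← Finset.prod_pow_eq_pow_sum]
  have h1 : ∀ a, ∏ b, ∏ i, ∏ j ∈ Finset.univ.erase i,
      F a b ^ (if z i = a ∧ z j = b ∧ P i j then 1 else 0) =
      ∏ i, ∏ j ∈ Finset.univ.erase i, ∏ b,
        F a b ^ (if z i = a ∧ z j = b ∧ P i j then 1 else 0) := fun a => by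
    rw [Finset.prod_comm]
    exact Finset.prod_congr rfl fun i _ => Finset.prod_comm
  simp only [h1]
  rw [Finset.prod_comm]
  refine Finset.prod_congr rfl fun i _ => ?_
  rw [Finset.prod_comm]
  refine Finset.prod_congr rfl fun j _ => ?_
  rw [Finset.prod_eq_single (z i), Finset.prod_eq_single (z j)]
  · by_cases h : P i j <;> simp [h]
  · intro b _ hb
    simp [hb.symm]
  · simp
  · intro a _ ha
    simp [ha.symm]
  · simp

theorem pairCount_sub_edgeCount {n K : ℕ} (A : SimpleGraph (Fin n)) (z : Labeling n K)
    (a b : Fin K) :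
    pairCount z a b - edgeCount A z a b =
      ∑ i, ∑ j ∈ Finset.univ.erase i, if z i = a ∧ z j = b ∧ ¬ A.Adj i j then 1 else 0 := by
  have h : pairCount z a b = edgeCount A z a b +
      ∑ i, ∑ j ∈ Finset.univ.erase i, if z i = a ∧ z j = b ∧ ¬ A.Adj i j then 1 else 0 := by
    unfold pairCount edgeCount
    rw [← Finset.sum_add_distrib]
    refine Finset.sum_congr rfl fun i _ => ?_
    rw [← Finset.sum_add_distrib]
    refine Finset.sum_congr rfl fun j _ => ?_
    by_cases h1 : z i = a <;> by_cases h2 : z j = b <;> by_cases h3 : A.Adj i j <;>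
      simp [h1, h2, h3]
  omega

/-- Each unordered pair occurs twice among the ordered ones; this square cancels the square root in
`completeLik`. -/
theorem prod_erase_eq_sq {n : ℕ} (w : Fin n → Fin n → ℝ) (hw : ∀ i j, w i j = w j i) :
    ∏ i, ∏ j ∈ Finset.univ.erase i, w i j =
      (∏ e : Fin n × Fin n with e.1 < e.2, w e.1 e.2) ^ 2 := by
  have h1 : ∏ i, ∏ j ∈ Finset.univ.erase i, w i j =
      ∏ e : Fin n × Fin n with e.1 ≠ e.2, w e.1 e.2 := by
    rw [Finset.prod_filter, Fintype.prod_prod_type]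
    refine Finset.prod_congr rfl fun i _ => ?_
    rw [← Finset.prod_filter]
    refine Finset.prod_congr ?_ fun _ _ => rfl
    ext j
    simp [eq_comm]
  have h2 : ∏ e : Fin n × Fin n with e.2 < e.1, w e.1 e.2 =
      ∏ e : Fin n × Fin n with e.1 < e.2, w e.1 e.2 := by
    refine Finset.prod_bij' (fun e _ => e.swap) (fun e _ => e.swap) ?_ ?_ ?_ ?_ ?_
    · simp
    · simp
    · simp
    · simp
    · intro e _
      exact hw _ _
  have h3 : (Finset.univ.filter fun e : Fin n × Fin n => e.1 ≠ e.2) =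
      (Finset.univ.filter fun e : Fin n × Fin n => e.1 < e.2) ∪
        (Finset.univ.filter fun e : Fin n × Fin n => e.2 < e.1) := by
    ext e
    simp [lt_or_lt_iff_ne]
  rw [h1, h3, Finset.prod_union, h2, sq]
  rw [Finset.disjoint_filter]
  intro e _ h
  exact h.not_gt

theorem prod_prob_pow_blockSize {n K : ℕ} (z : Labeling n K) (θ : Param K) :
    ∏ a, θ.prob a ^ blockSize z a = labelWeight θ z := by
  unfold blockSize labelWeight
  simp only [← Finset.prod_pow_eq_pow_sum]
  rw [Finset.prod_comm]
  refine Finset.prod_congr rfl fun i _ => ?_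
  rw [Finset.prod_eq_single (z i)]
  · simp
  · intro a _ ha
    simp [ha.symm]
  · simp

theorem completeLik_eq {n K : ℕ} (z : Labeling n K) (A : SimpleGraph (Fin n)) (θ : Param K) :
    completeLik z A θ = labelWeight θ z * graphWeight θ z A := by
  have key : ∏ a, ∏ b, θ.conn a b ^ edgeCount A z a b *
      (1 - θ.conn a b) ^ (pairCount z a b - edgeCount A z a b) = graphWeight θ z A ^ 2 := by
    simp only [pairCount_sub_edgeCount, Finset.prod_mul_distrib]
    unfold edgeCount
    rw [prod_pow_labelPairCount θ.conn z fun i j => A.Adj i j,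
      prod_pow_labelPairCount (fun a b => 1 - θ.conn a b) z fun i j => ¬ A.Adj i j]
    unfold graphWeight
    rw [← prod_erase_eq_sq fun i j =>
      if A.Adj i j then θ.conn (z i) (z j) else 1 - θ.conn (z i) (z j)]
    · simp only [← Finset.prod_mul_distrib]
      refine Finset.prod_congr rfl fun i _ => Finset.prod_congr rfl fun j _ => ?_
      by_cases h : A.Adj i j <;> simp [h]
    · intro i j
      simp only [A.adj_comm i j, θ.conn_symm.apply (z j) (z i)]
  unfold completeLik
  rw [key, Real.sqrt_sq (graphWeight_nonneg θ z A), prod_prob_pow_blockSize]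

theorem completeLik_nonneg {n K : ℕ} (z : Labeling n K) (A : SimpleGraph (Fin n))
    (θ : Param K) : 0 ≤ completeLik z A θ := by
  rw [completeLik_eq]
  exact mul_nonneg (labelWeight_nonneg θ z) (graphWeight_nonneg θ z A)

theorem completeLik_pos {n K : ℕ} (z : Labeling n K) (A : SimpleGraph (Fin n))
    (θ : Param K) : 0 < completeLik z A θ := by
  rw [completeLik_eq]
  refine mul_pos (Finset.prod_pos fun _ _ => θ.prob_pos _) (Finset.prod_pos fun e _ => ?_)
  split_ifs
  · exact θ.conn_pos _ _
  · linarith [θ.conn_lt_one (z e.1) (z e.2)]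

theorem labelWeight_le_one {n K : ℕ} (θ : Param K) (z : Labeling n K) :
    labelWeight θ z ≤ 1 := by
  rw [← sum_labelWeight (n := n) θ]
  exact Finset.single_le_sum (f := fun z => labelWeight θ z)
    (fun z _ => labelWeight_nonneg θ z) (Finset.mem_univ z)

theorem sum_completeLik_le_one {n K : ℕ} (z : Labeling n K) (θ : Param K)
    (s : Finset (SimpleGraph (Fin n))) : ∑ A ∈ s, completeLik z A θ ≤ 1 := by
  refine (Finset.sum_le_univ_sum_of_nonneg fun A => completeLik_nonneg z A θ).trans ?_
  simp only [completeLik_eq, ← Finset.mul_sum, sum_graphWeight, mul_one]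
  exact labelWeight_le_one θ z

theorem completeLik_le_one {n K : ℕ} (z : Labeling n K) (A : SimpleGraph (Fin n))
    (θ : Param K) : completeLik z A θ ≤ 1 := by
  simpa using sum_completeLik_le_one z θ {A}

/-- Needed because a real `⨆` over an unbounded family takes the default value zero. -/
theorem bddAbove_completeLik {n K : ℕ} (z : Labeling n K) (A : SimpleGraph (Fin n)) :
    BddAbove (Set.range fun θ : Param K => completeLik z A θ) :=
  ⟨1, by rintro _ ⟨θ, rfl⟩; exact completeLik_le_one z A θ⟩

theorem maxCompleteLik_nonneg {n K : ℕ} (z : Labeling n K) (A : SimpleGraph (Fin n)) :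
    0 ≤ maxCompleteLik z A :=
  Real.iSup_nonneg fun θ => completeLik_nonneg z A θ

/-! ### The likelihood as the marginal density of the graph -/

theorem lik_pos {n K : ℕ} (A : SimpleGraph (Fin n)) (θ : Param K) : 0 < lik A θ := by
  have hK : Nonempty (Fin K) := by
    by_contra h
    have := not_nonempty_iff.1 h
    simpa using θ.prob_sum
  exact Finset.sum_pos (fun z _ => completeLik_pos z A θ) Finset.univ_nonempty

theorem lik_le_sum_maxCompleteLik {n K : ℕ} (A : SimpleGraph (Fin n)) (θ : Param K) :
    lik A θ ≤ ∑ z : Labeling n K, maxCompleteLik z A :=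
  Finset.sum_le_sum fun z _ => le_ciSup (bddAbove_completeLik z A) θ

theorem bddAbove_lik {n : ℕ} (K : ℕ) (A : SimpleGraph (Fin n)) :
    BddAbove (Set.range fun θ : Param K => lik A θ) :=
  ⟨_, by rintro _ ⟨θ, rfl⟩; exact lik_le_sum_maxCompleteLik A θ⟩

theorem iSup_lik_pos {n K : ℕ} [h : Nonempty (Param K)] (A : SimpleGraph (Fin n)) :
    0 < ⨆ θ : Param K, lik A θ :=
  (lik_pos A h.some).trans_le (le_ciSup (bddAbove_lik K A) h.some)

theorem iSup_log_lik {n K : ℕ} [Nonempty (Param K)] (A : SimpleGraph (Fin n)) :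
    ⨆ θ : Param K, Real.log (lik A θ) = Real.log (⨆ θ : Param K, lik A θ) := by
  have hle : ∀ θ : Param K, Real.log (lik A θ) ≤ Real.log (⨆ θ : Param K, lik A θ) := fun θ =>
    Real.log_le_log (lik_pos A θ) (le_ciSup (bddAbove_lik K A) θ)
  refine le_antisymm (ciSup_le hle) ?_
  rw [Real.log_le_iff_le_exp (iSup_lik_pos A)]
  refine ciSup_le fun θ => ?_
  rw [← Real.log_le_iff_le_exp (lik_pos A θ)]
  exact le_ciSup (f := fun θ : Param K => Real.log (lik A θ))
    ⟨_, by rintro _ ⟨θ, rfl⟩; exact hle θ⟩ θ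

theorem law_graph {n K : ℕ} (θ : Param K) (E : Set (SimpleGraph (Fin n))) :
    (law n θ).toOuterMeasure {ω | ω.2 ∈ E} = ENNReal.ofReal (∑ A with A ∈ E, lik A θ) := by
  rw [PMF.toOuterMeasure_apply_fintype, Fintype.sum_prod_type_right,
    ENNReal.ofReal_sum_of_nonneg fun A _ => (lik_pos A θ).le, Finset.sum_filter]
  refine Finset.sum_congr rfl fun A _ => ?_
  by_cases hA : A ∈ E
  · rw [if_pos hA, lik, ENNReal.ofReal_sum_of_nonneg fun z _ => completeLik_nonneg z A θ]
    refine Finset.sum_congr rfl fun z _ => ?_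
    rw [Set.indicator_of_mem (by simpa using hA), completeLik_eq]
    rfl
  · rw [if_neg hA]
    exact Finset.sum_eq_zero fun z _ => Set.indicator_of_notMem (by simpa using hA) _

/-! ### The total mass of the maximized likelihood -/

theorem edgeCount_le {n K : ℕ} (A : SimpleGraph (Fin n)) (z : Labeling n K) (a b : Fin K) :
    edgeCount A z a b ≤ n ^ 2 := by
  have h : edgeCount A z a b ≤ ∑ _i : Fin n, ∑ _j : Fin n, 1 := by
    unfold edgeCount
    refine Finset.sum_le_sum fun i _ => ?_
    refine (Finset.sum_le_sum (g := fun _ => 1) fun j _ => ?_).trans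
      (Finset.sum_le_sum_of_subset (Finset.subset_univ _))
    split_ifs <;> simp
  simpa [sq] using h

/-- The edge counts of a labeling, as an element of a finite type. -/
noncomputable def edgeCounts {n K : ℕ} (z : Labeling n K) (A : SimpleGraph (Fin n)) :
    Fin K → Fin K → Fin (n ^ 2 + 1) :=
  fun a b => ⟨edgeCount A z a b, Nat.lt_succ_of_le (edgeCount_le A z a b)⟩

/-- Sufficiency: block sizes and pair counts do not involve the graph, so `A` enters only through
its edge counts. -/
theorem completeLik_congr {n K : ℕ} {z : Labeling n K} {A B : SimpleGraph (Fin n)}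
    (h : edgeCounts z A = edgeCounts z B) (θ : Param K) :
    completeLik z A θ = completeLik z B θ := by
  have h' : ∀ a b, edgeCount A z a b = edgeCount B z a b := fun a b =>
    congrArg Fin.val (congrFun (congrFun h a) b)
  simp only [completeLik, h']

/-- The summand is constant on the fiber, so the sum is cardinality times one supremum. For each
single `θ` the same product is a partial sum of a function of mass at most one, and the bound passes
to the supremum. -/
theorem sum_maxCompleteLik_fiber_le_one {n K : ℕ} (z : Labeling n K)
    (o : Fin K → Fin K → Fin (n ^ 2 + 1)) :
    ∑ A with edgeCounts z A = o, maxCompleteLik z A ≤ 1 := by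
  rcases (Finset.univ.filter fun A => edgeCounts z A = o).eq_empty_or_nonempty with h | ⟨B, hB⟩
  · simp [h]
  have hB' : edgeCounts z B = o := (Finset.mem_filter.1 hB).2
  have hcongr : ∀ A ∈ Finset.univ.filter fun A => edgeCounts z A = o, ∀ θ : Param K,
      completeLik z A θ = completeLik z B θ := fun A hA θ =>
    completeLik_congr ((Finset.mem_filter.1 hA).2.trans hB'.symm) θ
  rw [Finset.sum_congr rfl fun A hA => show maxCompleteLik z A = maxCompleteLik z B from
    congrArg iSup (funext (hcongr A hA)), Finset.sum_const, nsmul_eq_mul]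
  have hcard : (0 : ℝ) < #{A | edgeCounts z A = o} :=
    Nat.cast_pos.2 (Finset.card_pos.2 ⟨B, hB⟩)
  rw [mul_comm, ← le_div_iff₀ hcard]
  -- The nonnegativity side goal covers an empty parameter space, where the supremum is zero.
  refine Real.iSup_le (fun θ => ?_) (by positivity)
  rw [le_div_iff₀ hcard, mul_comm, ← nsmul_eq_mul, ← Finset.sum_const,
    ← Finset.sum_congr rfl fun A hA => hcongr A hA θ]
  exact sum_completeLik_le_one z θ _

theorem sum_sum_maxCompleteLik_le (n K : ℕ) :
    ∑ A : SimpleGraph (Fin n), ∑ z : Labeling n K, maxCompleteLik z A ≤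
      (K : ℝ) ^ n * ((n : ℝ) ^ 2 + 1) ^ (K * K) := by
  rw [Finset.sum_comm]
  have h : ∀ z : Labeling n K, ∑ A : SimpleGraph (Fin n), maxCompleteLik z A ≤
      ((n : ℝ) ^ 2 + 1) ^ (K * K) := fun z => by
    rw [← Finset.sum_fiberwise (s := Finset.univ) (g := edgeCounts z)]
    refine (Finset.sum_le_sum fun o _ => sum_maxCompleteLik_fiber_le_one z o).trans_eq ?_
    simp [pow_mul]
  refine (Finset.sum_le_sum fun z _ => h z).trans_eq ?_
  simp

/-! ### Nesting of the models -/

/-- The parameter of the larger model obtained by splitting the blocks of `θ` evenly along a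
surjection of the labels. -/
noncomputable def Param.split {K K' : ℕ} (s : Fin K' → Fin K) (hs : Function.Surjective s) (θ : Param K) :
    Param K' where
  prob k := θ.prob (s k) / #{l | s l = s k}
  conn := θ.conn.submatrix s s
  prob_pos k := div_pos (θ.prob_pos _) (Nat.cast_pos.2 (Finset.card_pos.2 ⟨k, by simp⟩))
  prob_sum := by
    rw [← Finset.sum_fiberwise (s := Finset.univ) (g := s), ← θ.prob_sum]
    refine Finset.sum_congr rfl fun a _ => ?_
    obtain ⟨k, hk⟩ := hs a
    have hcard : (0 : ℝ) < #{l | s l = a} :=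
      Nat.cast_pos.2 (Finset.card_pos.2 ⟨k, by simp [hk]⟩)
    rw [Finset.sum_congr rfl fun l hl => show _ = θ.prob a / #{l | s l = a} by
      rw [(Finset.mem_filter.1 hl).2], Finset.sum_const, nsmul_eq_mul]
    field_simp
  conn_symm := θ.conn_symm.submatrix s
  conn_pos _ _ := θ.conn_pos _ _
  conn_lt_one _ _ := θ.conn_lt_one _ _

theorem Param.sum_split_prob_fiber {K K' : ℕ} (s : Fin K' → Fin K) (hs : Function.Surjective s)
    (θ : Param K) (a : Fin K) : ∑ k with s k = a, (θ.split s hs).prob k = θ.prob a := by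
  obtain ⟨k, hk⟩ := hs a
  have hcard : (0 : ℝ) < #{l | s l = a} :=
    Nat.cast_pos.2 (Finset.card_pos.2 ⟨k, by simp [hk]⟩)
  rw [Finset.sum_congr rfl fun l hl => show _ = θ.prob a / #{l | s l = a} by
    simp only [Param.split]
    rw [(Finset.mem_filter.1 hl).2], Finset.sum_const, nsmul_eq_mul]
  field_simp

/-- Merging labels along `s` leaves the graph factor unchanged, and summing label weights over the
refinements of `z` factors over nodes, restoring the original block probabilities. -/
theorem lik_split {n K K' : ℕ} (s : Fin K' → Fin K) (hs : Function.Surjective s)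
    (A : SimpleGraph (Fin n)) (θ : Param K) : lik A (θ.split s hs) = lik A θ := by
  unfold lik
  rw [← Finset.sum_fiberwise (s := Finset.univ) (g := fun z : Labeling n K' => s ∘ z)]
  refine Finset.sum_congr rfl fun z _ => ?_
  have hg : ∀ y ∈ Finset.univ.filter fun y : Labeling n K' => s ∘ y = z,
      completeLik y A (θ.split s hs) = labelWeight (θ.split s hs) y * graphWeight θ z A := by
    intro y hy
    obtain rfl := (Finset.mem_filter.1 hy).2
    exact completeLik_eq y A _
  rw [Finset.sum_congr rfl hg, ← Finset.sum_mul, completeLik_eq]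
  congr 1
  have hfilter : (Finset.univ.filter fun y : Labeling n K' => s ∘ y = z) =
      Fintype.piFinset fun i => Finset.univ.filter fun k => s k = z i := by
    ext y
    simp [Fintype.mem_piFinset, funext_iff]
  unfold labelWeight
  rw [hfilter, ← Finset.prod_univ_sum]
  exact Finset.prod_congr rfl fun i _ => Param.sum_split_prob_fiber s hs θ (z i)

theorem iSup_lik_mono {n K K' : ℕ} [hne : Nonempty (Param K)] (h : K ≤ K')
    (A : SimpleGraph (Fin n)) : ⨆ θ : Param K, lik A θ ≤ ⨆ θ : Param K', lik A θ := by
  have hK : Nonempty (Fin K) := by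
    by_contra h0
    have := not_nonempty_iff.1 h0
    simpa using hne.some.prob_sum
  -- A left inverse of the inclusion `Fin K → Fin K'` serves as the surjection of labels.
  have hs := Function.invFun_surjective (Fin.castLE_injective h)
  refine ciSup_le fun θ => ?_
  rw [← lik_split _ hs A θ]
  exact le_ciSup (bddAbove_lik K' A) _

theorem Param.nonempty_of_le {K K' : ℕ} (θ : Param K) (h : K ≤ K') : Nonempty (Param K') := by
  have hK : Nonempty (Fin K) := by
    by_contra h0
    have := not_nonempty_iff.1 h0
    simpa using θ.prob_sum
  exact ⟨θ.split _ (Function.invFun_surjective (Fin.castLE_injective h))⟩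

theorem logLikRatio_nonneg {n K K' : ℕ} [Nonempty (Param K)] (h : K ≤ K')
    (A : SimpleGraph (Fin n)) : 0 ≤ logLikRatio K K' A :=
  Real.log_nonneg ((one_le_div (iSup_lik_pos A)).2 (iSup_lik_mono h A))

/-! ### Tail bound for the likelihood ratio -/

theorem law_lt_logLikRatio_le {n K K' : ℕ} (hK : K ≤ K') (θ : Param K) (t : ℝ) :
    (law n θ).toOuterMeasure {ω | t < logLikRatio K K' ω.2} ≤
      ENNReal.ofReal (Real.exp (-t) * ((K' : ℝ) ^ n * ((n : ℝ) ^ 2 + 1) ^ (K' * K'))) := by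
  have : Nonempty (Param K) := ⟨θ⟩
  have : Nonempty (Param K') := θ.nonempty_of_le hK
  rw [show {ω : Outcome n K | t < logLikRatio K K' ω.2} =
    {ω | ω.2 ∈ {A | t < logLikRatio K K' A}} from rfl, law_graph]
  refine ENNReal.ofReal_le_ofReal ?_
  refine le_trans ?_ (mul_le_mul_of_nonneg_left (sum_sum_maxCompleteLik_le n K')
    (Real.exp_pos _).le)
  rw [Finset.mul_sum]
  refine (Finset.sum_le_sum fun A hA => ?_).trans (Finset.sum_le_univ_sum_of_nonneg fun A =>
    mul_nonneg (Real.exp_pos _).le (Finset.sum_nonneg fun z _ => maxCompleteLik_nonneg z A))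
  have hA' : t < logLikRatio K K' A := (Finset.mem_filter.1 hA).2
  unfold logLikRatio at hA'
  rw [Real.lt_log_iff_exp_lt (div_pos (iSup_lik_pos A) (iSup_lik_pos A)),
    lt_div_iff₀ (iSup_lik_pos A)] at hA'
  have h1 : Real.exp t * lik A θ ≤ ∑ z : Labeling n K', maxCompleteLik z A :=
    (mul_le_mul_of_nonneg_left (le_ciSup (bddAbove_lik K A) θ) (Real.exp_pos t).le).trans
      (hA'.le.trans (ciSup_le fun θ' => lik_le_sum_maxCompleteLik A θ'))
  calc lik A θ = Real.exp (-t) * (Real.exp t * lik A θ) := by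
        rw [← mul_assoc, ← Real.exp_add, neg_add_cancel, Real.exp_zero, one_mul]
    _ ≤ _ := mul_le_mul_of_nonneg_left h1 (Real.exp_pos _).le

theorem tendsto_exp_neg_mul_sq_add_one_pow (m : ℕ) :
    Tendsto (fun n : ℕ => Real.exp (-(n : ℝ)) * ((n : ℝ) ^ 2 + 1) ^ m) atTop (𝓝 0) := by
  have h := (Real.tendsto_pow_mul_exp_neg_atTop_nhds_zero (2 * m)).comp
    (tendsto_natCast_atTop_atTop (R := ℝ))
  have h2 := h.const_mul ((2 : ℝ) ^ m)
  rw [mul_zero] at h2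
  refine squeeze_zero' (Eventually.of_forall fun n => by positivity) ?_ h2
  filter_upwards [eventually_ge_atTop 1] with n hn
  have hn' : (1 : ℝ) ≤ n := by exact_mod_cast hn
  have h3 : ((n : ℝ) ^ 2 + 1) ^ m ≤ (2 * (n : ℝ) ^ 2) ^ m :=
    pow_le_pow_left₀ (by positivity) (by nlinarith) m
  calc Real.exp (-(n : ℝ)) * ((n : ℝ) ^ 2 + 1) ^ m
      ≤ Real.exp (-(n : ℝ)) * (2 * (n : ℝ) ^ 2) ^ m :=
        mul_le_mul_of_nonneg_left h3 (Real.exp_pos _).le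
    _ = _ := by
        simp only [Function.comp]
        rw [mul_pow, ← pow_mul]
        ring

/-- The log likelihood ratio of an overfitted model exceeds `(log K' + 1) n` with vanishing
probability, whatever the true parameters are. -/
theorem tendsto_law_lt_logLikRatio {K K' : ℕ} (hK : K ≤ K') (θ : ℕ → Param K) :
    Tendsto (fun n : ℕ => (law n (θ n)).toOuterMeasure
      {ω | (Real.log K' + 1) * n < logLikRatio K K' ω.2}) atTop (𝓝 0) := by
  have hlim := ENNReal.tendsto_ofReal (tendsto_exp_neg_mul_sq_add_one_pow (K' * K'))
  rw [ENNReal.ofReal_zero] at hlim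
  refine tendsto_of_tendsto_of_tendsto_of_le_of_le tendsto_const_nhds hlim
    (fun _ => zero_le) fun n => (law_lt_logLikRatio_le hK (θ n) _).trans_eq ?_
  have hK' : (0 : ℝ) < K' := by
    have h0 : K ≠ 0 := by
      rintro rfl
      simpa using (θ 0).prob_sum
    exact_mod_cast (Nat.pos_of_ne_zero h0).trans_le hK
  -- The `log K'` part of the threshold cancels the number of labelings exactly; the extra `1`
  -- leaves `exp (-n)` to beat the polynomial.
  have hexp : Real.exp (Real.log K' * n) = (K' : ℝ) ^ n := by
    rw [mul_comm, Real.exp_nat_mul, Real.exp_log hK']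
  congr 1
  rw [add_mul, one_mul, neg_add, Real.exp_add, Real.exp_neg (Real.log K' * n), hexp]
  field_simp

theorem criterion_lt_criterion {n K K' : ℕ} [Nonempty (Param K)] [Nonempty (Param K')]
    (hK : K < K') {lam : ℝ} (hlam : 0 < lam) (A : SimpleGraph (Fin n))
    (h : logLikRatio K K' A < lam * (n * Real.log n)) :
    criterion lam K' A < criterion lam K A := by
  unfold criterion
  unfold logLikRatio at h
  rw [iSup_log_lik, iSup_log_lik]
  rw [Real.log_div (iSup_lik_pos A).ne' (iSup_lik_pos A).ne'] at h
  have hn : 0 ≤ lam * (n * Real.log n) :=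
    mul_nonneg hlam.le (mul_nonneg n.cast_nonneg (Real.log_natCast_nonneg n))
  have hKr : (K : ℝ) + 1 ≤ K' := by exact_mod_cast hK
  have hK0 : (0 : ℝ) ≤ K := K.cast_nonneg
  -- Already for `K' = K + 1` the difference is `K + 1`.
  have hdiff : 1 ≤ (K' : ℝ) * (K' + 1) / 2 - (K : ℝ) * (K + 1) / 2 := by nlinarith
  have := mul_le_mul_of_nonneg_right hdiff hn
  linarith

end SBM

theorem theorem3 (K Kplus : ℕ) (hK : K < Kplus)
    (p : Fin K → ℝ) (S : Matrix (Fin K) (Fin K) ℝ) (ρ : ℕ → ℝ)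
    (θ : ℕ → SBM.Param K)
    (hp : ∀ n, (θ n).prob = p) (hS : ∀ n, (θ n).conn = ρ n • S)
    (hcol : Function.Injective S.transpose)
    (hρ : Tendsto (fun n : ℕ => n * ρ n / Real.log n) atTop atTop)
    (ε C : ℝ) (hε : 0 < ε) (hC : 0 ≤ C)
    (hmax : SBM.BalancedMax θ Kplus ε C) :
    SBM.IsBigOP (fun n => SBM.law n (θ n))
      (fun _ ω => SBM.logLikRatio K Kplus ω.2) (fun n => (n : ℝ)) ∧
    ∀ lam : ℝ, 0 < lam →
      Tendsto (fun n : ℕ => (SBM.law n (θ n)).toOuterMeasure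
        {ω | SBM.criterion lam Kplus ω.2 < SBM.criterion lam K ω.2}) atTop (𝓝 1) := by
  have : Nonempty (SBM.Param K) := ⟨θ 0⟩
  have : Nonempty (SBM.Param Kplus) := (θ 0).nonempty_of_le hK.le
  have htail := SBM.tendsto_law_lt_logLikRatio hK.le θ
  refine ⟨fun δ hδ => ⟨Real.log Kplus + 1, ?_⟩, fun lam hlam => ?_⟩
  · filter_upwards [htail.eventually_le_const (ENNReal.ofReal_pos.2 hδ)] with n hn
    refine le_trans (MeasureTheory.measure_mono fun ω hω => ?_) hn
    simpa [abs_of_nonneg (SBM.logLikRatio_nonneg hK.le ω.2)] using hω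
  -- Past this threshold `(log Kplus + 1) * n < lam * (n * log n)`, so the criterion can fail only
  -- on the tail event.
  · have hlog : ∀ᶠ n : ℕ in atTop, (Real.log Kplus + 1) / lam < Real.log n :=
      (Real.tendsto_log_atTop.comp tendsto_natCast_atTop_atTop).eventually_gt_atTop _
    have hlim := ENNReal.Tendsto.sub (tendsto_const_nhds (x := (1 : ℝ≥0∞))) htail
      (Or.inl ENNReal.one_ne_top)
    rw [tsub_zero] at hlim
    refine tendsto_of_tendsto_of_tendsto_of_le_of_le' hlim tendsto_const_nhds ?_ ?_
    · filter_upwards [hlog, eventually_gt_atTop 0] with n hn hn0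
      have hn0' : (0 : ℝ) < n := Nat.cast_pos.2 hn0
      rw [tsub_le_iff_left]
      have huniv : (SBM.law n (θ n)).toOuterMeasure Set.univ = 1 :=
        ((SBM.law n (θ n)).toOuterMeasure_apply_eq_one_iff _).2 (Set.subset_univ _)
      rw [← huniv]
      refine le_trans (MeasureTheory.measure_mono fun ω _ => ?_)
        (MeasureTheory.measure_union_le _ _)
      rcases lt_or_ge ((Real.log Kplus + 1) * n) (SBM.logLikRatio K Kplus ω.2) with h | h
      · exact Or.inl h
      · refine Or.inr (SBM.criterion_lt_criterion hK hlam ω.2 (h.trans_lt ?_))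
        rw [div_lt_iff₀ hlam] at hn
        nlinarith
    · refine Eventually.of_forall fun n => ?_
      have huniv : (SBM.law n (θ n)).toOuterMeasure Set.univ = 1 :=
        ((SBM.law n (θ n)).toOuterMeasure_apply_eq_one_iff _).2 (Set.subset_univ _)
      rw [← huniv]
      exact MeasureTheory.measure_mono (Set.subset_univ _)
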